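/- Let $u:[0,\infty)\times[0,\infty)\to\mathbb R$, $(t,x)\mapsto u(t,x)$, be such that $$u\in C\bigl([0,\infty),\,C^1([0,\infty))\cap C^2((0,\infty))\bigr)\cap C^1\bigl((0,\infty),\,C((0,\infty))\bigr),$$ where the spaces of functions of $x$ carry the topology of locally uniform convergence of the function and of the derivatives in question. That is: for every $t\ge 0$ the function $u(t,\cdot)$ is $C^1$ on $[0,\infty)$ (with one-sided derivative at $0$) and $C^2$ on $(0,\infty)$; as $t$ varies in $[0,\infty)$, $u(t,\cdot)$ and $u_x(t,\cdot)$ vary continuously with respect to locally uniform convergence on $[0,\infty)$, and $u_{xx}(t,\cdot)$ with respect to locally uniform convergence on $(0,\infty)$; and $t\mapsto u(t,\cdot)$ is continuously differentiable on $(0,\infty)$ as a map into $C((0,\infty))$ with the topology of locally uniform convergence. Suppose that $u$ is bounded on $G=\{(t,x): t,x>0\}$ and satisfies the heat equation $u_t=u_{xx}$ in $G$. Then $u$ has the boundary values $$v(x)=\lim_{t\to 0+}u(t,x)=u(0,x)\quad(x>0),\qquad \varphi(t)=\lim_{x\to 0+}u(t,x)=u(t,0)\quad(t>0),$$ $$\psi(t)=\lim_{x\to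 0+}u_x(t,x)=u_x(t,0)\quad(t>0),$$ where $u_x(t,0)$ is the one-sided derivative; the functions $v,\varphi,\psi$ are continuous on $(0,\infty)$; and for every $t>0$ both integrals below converge absolutely and $$\varphi(t)=\frac1{\sqrt{\pi t}}\int_0^\infty e^{-\xi^2/(4t)}\,v(\xi)\,d\xi-\frac1{\sqrt\pi}\int_0^t\frac1{\sqrt\tau}\,\psi(t-\tau)\,d\tau .$$ -/

import Mathlib

open Real Set Filter Topology MeasureTheory

/-- `f ∈ C(T, C(S))`: every slice `f t` with `t ∈ T` is continuous on `S`, and `t ↦ f t` is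
continuous on `T` for the topology of locally uniform convergence on `S`. -/
def MemCC (T S : Set ℝ) (f : ℝ → ℝ → ℝ) : Prop :=
  (∀ t ∈ T, ContinuousOn (f t) S) ∧
    ∀ t ∈ T, TendstoLocallyUniformlyOn f (f t) (𝓝[T] t) S

/-- `f ∈ C¹(T, C(S))`, for an open set `T` of times: `t ↦ f t` is differentiable as a map into
`C(S)` (the difference quotients converge locally uniformly on `S`), and its derivative is a
continuous map `T → C(S)`. -/
def MemC1C (T S : Set ℝ) (f : ℝ → ℝ → ℝ) : Prop :=
  MemCC T S f ∧ ∃ f' : ℝ → ℝ → ℝ, MemCC T S f' ∧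
    ∀ t ∈ T, TendstoLocallyUniformlyOn (fun h x => (f (t + h) x - f t x) / h) (f' t) (𝓝[≠] 0) S

/-- `f ∈ C([0,∞), C¹([0,∞)) ∩ C²((0,∞)))`: every slice `f t` with `t ≥ 0` is `C¹` on `[0,∞)`
(one-sided derivative at `0`) and `C²` on `(0,∞)`, and as `t` varies in `[0,∞)` the functions
`f t` and `(f t)'` vary continuously in `C([0,∞))`, and `(f t)''` in `C((0,∞))`. -/
def MemCC1C2 (f : ℝ → ℝ → ℝ) : Prop :=
  (∀ t ∈ Ici (0 : ℝ), ContDiffOn ℝ 1 (f t) (Ici 0) ∧ ContDiffOn ℝ 2 (f t) (Ioi 0)) ∧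
    MemCC (Ici 0) (Ici 0) f ∧
    MemCC (Ici 0) (Ici 0) (fun t => derivWithin (f t) (Ici 0)) ∧
    MemCC (Ici 0) (Ioi 0) (fun t => deriv (deriv (f t)))

/-! Let N(σ, x) = exp(-x²/(4σ))/√(πσ). As a function of (s, x), N(t - s, x) solves the backward heat
equation, is even in x and has mass 1 on the half line. Green's identity for u and N over (0, t) ×
(0, ∞) therefore leaves three terms: the pole at (t, 0) gives φ(t), the bottom gives the integral of
N(t, ·)v, and the side x = 0 gives only the flux term with ψ, since N_x(σ, 0) = 0.

Three obstacles are removed with a single parameter e → 0+. The solution is shifted to u(s + e, x +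
e), because u_t and u_xx are available only inside the quadrant. The pole is moved to time t + e, so
that the kernel is smooth on the rectangle. The kernel is cut off at x = 1/e, because u_x is not
assumed bounded at infinity. For e > 0, `heat_green_cutoff` gives Green's identity up to an error of
at most 80e²Mt. The three terms converge by dominated convergence:
`tendsto_integral_heatKernel_pole`, `tendsto_integral_heatKernel_initial` and
`tendsto_integral_heatKernel_flux`. Joint continuity of u and u_x up to the boundary gives the
boundary values and supplies the pointwise limits. -/

/-- A map in `C(T, C(S))` is jointly continuous on `T × S`. -/
lemma MemCC.continuousOn_uncurry {T S : Set ℝ} {f : ℝ → ℝ → ℝ} (hf : MemCC T S f) :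
    ContinuousOn (Function.uncurry f) (T ×ˢ S) := by
  rintro ⟨t, x⟩ ⟨ht, hx⟩
  have hfst : Tendsto (Prod.fst : ℝ × ℝ → ℝ) (𝓝[T ×ˢ S] (t, x)) (𝓝[T] t) :=
    tendsto_nhdsWithin_iff.2 ⟨continuous_fst.continuousAt.continuousWithinAt,
      eventually_nhdsWithin_of_forall fun p hp => hp.1⟩
  have hsnd : Tendsto (Prod.snd : ℝ × ℝ → ℝ) (𝓝[T ×ˢ S] (t, x)) (𝓝[S] x) :=
    tendsto_nhdsWithin_iff.2 ⟨continuous_snd.continuousAt.continuousWithinAt,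
      eventually_nhdsWithin_of_forall fun p hp => hp.2⟩
  exact tendsto_comp_of_locally_uniform_limit_within (F := fun p : ℝ × ℝ => f p.1)
    (hf.1 t ht x hx) hsnd fun V hV => by
      obtain ⟨W, hW, h⟩ := hf.2 t ht V hV x hx
      exact ⟨W, hW, hfst.eventually h⟩

/-- A map in `C¹(T, C(S))` is differentiable in time at every point of `T × S`. -/
lemma MemC1C.differentiableAt {T S : Set ℝ} {f : ℝ → ℝ → ℝ} (hf : MemC1C T S f) {t x : ℝ}
    (ht : t ∈ T) (hx : x ∈ S) : DifferentiableAt ℝ (fun s => f s x) t := by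
  obtain ⟨-, f', -, h⟩ := hf
  have := (h t ht).tendsto_at hx
  refine HasDerivAt.differentiableAt (f' := f' t x) (hasDerivAt_iff_tendsto_slope_zero.2 ?_)
  refine this.congr fun h => ?_
  simp [div_eq_inv_mul]

/-! ### Green's identity on a rectangle -/

/-- Green's identity on a rectangle for a solution `U` of the heat equation and a weight `K` which
solves the backward heat equation up to the error `E`. -/
lemma heat_green_identity {t R : ℝ} (ht : 0 ≤ t) (hR : 0 ≤ R)
    {U Ux Uxx K Kx Kxx E : ℝ → ℝ → ℝ}
    (cU : ContinuousOn (Function.uncurry U) (Icc 0 t ×ˢ Icc 0 R))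
    (cUxx : ContinuousOn (Function.uncurry Uxx) (Icc 0 t ×ˢ Icc 0 R))
    (cUx : ContinuousOn (fun s => Ux s 0) (Icc 0 t))
    (cK : ContinuousOn (Function.uncurry K) (Icc 0 t ×ˢ Icc 0 R))
    (cKxx : ContinuousOn (Function.uncurry Kxx) (Icc 0 t ×ˢ Icc 0 R))
    (cE : ContinuousOn (Function.uncurry E) (Icc 0 t ×ˢ Icc 0 R))
    (dU : ∀ s ∈ Icc 0 t, ∀ x ∈ Icc 0 R, HasDerivAt (U s) (Ux s x) x)
    (dUx : ∀ s ∈ Icc 0 t, ∀ x ∈ Icc 0 R, HasDerivAt (Ux s) (Uxx s x) x)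
    (dUt : ∀ s ∈ Icc 0 t, ∀ x ∈ Icc 0 R, HasDerivAt (fun r => U r x) (Uxx s x) s)
    (dK : ∀ s ∈ Icc 0 t, ∀ x ∈ Icc 0 R, HasDerivAt (K s) (Kx s x) x)
    (dKx : ∀ s ∈ Icc 0 t, ∀ x ∈ Icc 0 R, HasDerivAt (Kx s) (Kxx s x) x)
    (dKt : ∀ s ∈ Icc 0 t, ∀ x ∈ Icc 0 R, HasDerivAt (fun r => K r x) (E s x - Kxx s x) s)
    (K_R : ∀ s ∈ Icc 0 t, K s R = 0) (Kx_R : ∀ s ∈ Icc 0 t, Kx s R = 0)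
    (Kx_0 : ∀ s ∈ Icc 0 t, Kx s 0 = 0) :
    (∫ x in (0 : ℝ)..R, K t x * U t x) - (∫ x in (0 : ℝ)..R, K 0 x * U 0 x) =
      (∫ s in (0 : ℝ)..t, ∫ x in (0 : ℝ)..R, E s x * U s x)
        - ∫ s in (0 : ℝ)..t, K s 0 * Ux s 0 := by
  have slice_s : ∀ {F : ℝ → ℝ → ℝ}, ContinuousOn (Function.uncurry F) (Icc 0 t ×ˢ Icc 0 R) →
      ∀ x ∈ Icc 0 R, ContinuousOn (fun s => F s x) (Icc 0 t) := fun {F} hF x hx =>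
    hF.comp (f := fun s => (s, x)) (by fun_prop) fun s hs => ⟨hs, hx⟩
  have slice_x : ∀ {F : ℝ → ℝ → ℝ}, ContinuousOn (Function.uncurry F) (Icc 0 t ×ˢ Icc 0 R) →
      ∀ s ∈ Icc 0 t, ContinuousOn (F s) (Icc 0 R) := fun {F} hF s hs =>
    hF.comp (f := fun x => (s, x)) (by fun_prop) fun x hx => ⟨hs, hx⟩
  have h0t : (0 : ℝ) ∈ Icc 0 t := ⟨le_rfl, ht⟩
  have htt : t ∈ Icc 0 t := ⟨ht, le_rfl⟩
  have h0R : (0 : ℝ) ∈ Icc 0 R := ⟨le_rfl, hR⟩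
  -- G = ∂ₛ(KU), while G - EU = ∂ₓ(K Uₓ - Kₓ U). Integrating G in both orders gives the identity.
  set G : ℝ → ℝ → ℝ := fun s x => (E s x - Kxx s x) * U s x + K s x * Uxx s x with hG
  have cG : ContinuousOn (Function.uncurry G) (Icc 0 t ×ˢ Icc 0 R) :=
    ((cE.sub cKxx).mul cU).add (cK.mul cUxx)
  have cEU : ContinuousOn (Function.uncurry fun s x => E s x * U s x) (Icc 0 t ×ˢ Icc 0 R) :=
    cE.mul cU
  have time : ∀ x ∈ Icc 0 R, ∫ s in (0 : ℝ)..t, G s x = K t x * U t x - K 0 x * U 0 x := by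
    intro x hx
    refine intervalIntegral.integral_eq_sub_of_hasDerivAt (f := fun s => K s x * U s x) ?_ ?_
    · intro s hs
      rw [uIcc_of_le ht] at hs
      exact (dKt s hs x hx).mul (dUt s hs x hx)
    · exact (slice_s cG x hx).intervalIntegrable_of_Icc ht
  have space : ∀ s ∈ Icc 0 t, ∫ x in (0 : ℝ)..R, G s x =
      (∫ x in (0 : ℝ)..R, E s x * U s x) - K s 0 * Ux s 0 := by
    intro s hs
    have ftc : ∫ x in (0 : ℝ)..R, (G s x - E s x * U s x) =
        (K s R * Ux s R - Kx s R * U s R) - (K s 0 * Ux s 0 - Kx s 0 * U s 0) := by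
      refine intervalIntegral.integral_eq_sub_of_hasDerivAt
        (f := fun x => K s x * Ux s x - Kx s x * U s x) ?_ ?_
      · intro x hx
        rw [uIcc_of_le hR] at hx
        refine (((dK s hs x hx).mul (dUx s hs x hx)).sub
          ((dKx s hs x hx).mul (dU s hs x hx))).congr_deriv ?_
        simp only [hG]; ring
      · exact ((slice_x cG s hs).sub (slice_x cEU s hs)).intervalIntegrable_of_Icc hR
    rw [intervalIntegral.integral_sub ((slice_x cG s hs).intervalIntegrable_of_Icc hR)
      ((slice_x cEU s hs).intervalIntegrable_of_Icc hR), K_R s hs, Kx_R s hs, Kx_0 s hs] at ftc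
    linarith
  have int_rect : ∀ {F : ℝ → ℝ → ℝ}, ContinuousOn (Function.uncurry F) (Icc 0 t ×ˢ Icc 0 R) →
      IntegrableOn (Function.uncurry F) (Ioc 0 t ×ˢ Ioc 0 R) := fun hF =>
    (hF.integrableOn_compact (isCompact_Icc.prod isCompact_Icc)).mono_set
      (prod_mono Ioc_subset_Icc_self Ioc_subset_Icc_self)
  have swap : ∫ s in (0 : ℝ)..t, ∫ x in (0 : ℝ)..R, G s x =
      ∫ x in (0 : ℝ)..R, ∫ s in (0 : ℝ)..t, G s x := by
    refine intervalIntegral_intervalIntegral_swap ?_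
    rw [uIoc_of_le ht, uIoc_of_le hR]
    exact int_rect cG
  have hEU : IntervalIntegrable (fun s => ∫ x in (0 : ℝ)..R, E s x * U s x) volume 0 t := by
    rw [intervalIntegrable_iff_integrableOn_Ioc_of_le ht]
    have := int_rect cEU
    rw [IntegrableOn, Measure.volume_eq_prod, ← Measure.prod_restrict] at this
    simp only [intervalIntegral.integral_of_le hR]
    exact this.integral_prod_left
  have hKU : ∀ s ∈ Icc 0 t, IntervalIntegrable (fun x => K s x * U s x) volume 0 R := fun s hs =>
    ((slice_x cK s hs).mul (slice_x cU s hs)).intervalIntegrable_of_Icc hR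
  have hKUx : IntervalIntegrable (fun s => K s 0 * Ux s 0) volume 0 t :=
    ((slice_s cK 0 h0R).mul cUx).intervalIntegrable_of_Icc ht
  rw [← intervalIntegral.integral_sub (hKU t htt) (hKU 0 h0t),
    ← intervalIntegral.integral_sub hEU hKUx]
  rw [← intervalIntegral.integral_congr (f := fun x => ∫ s in (0 : ℝ)..t, G s x), ← swap]
  · refine intervalIntegral.integral_congr fun s hs => ?_
    rw [uIcc_of_le ht] at hs
    exact space s hs
  · intro x hx
    rw [uIcc_of_le hR] at hx
    exact time x hx

/-! ### The heat kernel: derivatives and Gaussian bounds -/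

/-- The Neumann heat kernel of the half line with pole at the origin. -/
noncomputable def heatKernel (σ x : ℝ) : ℝ := exp (-x ^ 2 / (4 * σ)) / √(π * σ)

lemma heatKernel_nonneg (σ x : ℝ) : 0 ≤ heatKernel σ x := by
  unfold heatKernel; positivity

lemma hasDerivAt_heatKernel_space (σ x : ℝ) :
    HasDerivAt (heatKernel σ) (heatKernel σ x * (-x / (2 * σ))) x := by
  have h : HasDerivAt (fun y : ℝ => -y ^ 2 / (4 * σ)) (-x / (2 * σ)) x := by
    refine (((hasDerivAt_pow 2 x).neg).div_const (4 * σ)).congr_deriv ?_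
    simp only [mul_comm (4 : ℝ), mul_comm (2 : ℝ) σ, ← div_div]
    push_cast; ring
  refine (h.exp.div_const (√(π * σ))).congr_deriv ?_
  unfold heatKernel; ring

lemma hasDerivAt_heatKernel_time {σ : ℝ} (hσ : 0 < σ) (x : ℝ) :
    HasDerivAt (fun r => heatKernel r x)
      (heatKernel σ x * (x ^ 2 / (4 * σ ^ 2) - 1 / (2 * σ))) σ := by
  have h1 : HasDerivAt (fun r : ℝ => -x ^ 2 / (4 * r)) (x ^ 2 / (4 * σ ^ 2)) σ := by
    refine ((hasDerivAt_const σ (-x ^ 2)).div ((hasDerivAt_id σ).const_mul 4)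
      (by simpa using hσ.ne')).congr_deriv ?_
    simp only [id]; field_simp; ring
  have hs : 0 < √(π * σ) := by positivity
  have h2 : HasDerivAt (fun r : ℝ => √(π * r)) (π / (2 * √(π * σ))) σ := by
    simpa using ((hasDerivAt_id σ).const_mul π).sqrt (by simp; positivity)
  refine (h1.exp.div h2 hs.ne').congr_deriv ?_
  have hsq : √(π * σ) ^ 2 = π * σ := Real.sq_sqrt (by positivity)
  unfold heatKernel
  rw [mul_sub, sub_div]
  congr 1
  · field_simp
  · rw [hsq]
    field_simp

lemma continuousOn_heatKernel :
    ContinuousOn (Function.uncurry heatKernel) (Ioi 0 ×ˢ univ) := by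
  unfold heatKernel Function.uncurry
  refine ContinuousOn.div ?_ (by fun_prop) ?_
  · refine (ContinuousOn.div (by fun_prop) (by fun_prop) ?_).rexp
    rintro p ⟨hp, -⟩
    simpa using (mem_Ioi.1 hp).ne'
  · rintro p ⟨hp, -⟩
    have : 0 < p.1 := hp
    positivity

/-- Half of the Gaussian exponent absorbs the polynomial factor: y ≤ exp y with y = x²/(8σ). -/
lemma heatKernel_mul_sq_div_le {σ : ℝ} (hσ : 0 < σ) (x : ℝ) :
    heatKernel σ x * (x ^ 2 / σ) ≤ 8 * (exp (-(1 / (8 * σ)) * x ^ 2) / √(π * σ)) := by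
  have h : x ^ 2 / (8 * σ) ≤ exp (x ^ 2 / (8 * σ)) := by
    linarith [add_one_le_exp (x ^ 2 / (8 * σ))]
  have e : exp (-(1 / (8 * σ)) * x ^ 2) = exp (-x ^ 2 / (4 * σ)) * exp (x ^ 2 / (8 * σ)) := by
    rw [← exp_add]; congr 1; field_simp; ring
  have e2 : x ^ 2 / σ = 8 * (x ^ 2 / (8 * σ)) := by field_simp
  unfold heatKernel
  rw [e, e2]
  calc _ = 8 * (exp (-x ^ 2 / (4 * σ)) * (x ^ 2 / (8 * σ)) / √(π * σ)) := by ring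
    _ ≤ _ := by gcongr

lemma heatKernel_le {σ : ℝ} (hσ : 0 < σ) (x : ℝ) :
    heatKernel σ x ≤ exp (-(1 / (8 * σ)) * x ^ 2) / √(π * σ) := by
  unfold heatKernel
  gcongr
  have : 0 ≤ x ^ 2 / (8 * σ) := by positivity
  have e2 : -x ^ 2 / (4 * σ) = -(1 / (8 * σ)) * x ^ 2 - x ^ 2 / (8 * σ) := by field_simp; ring
  linarith

/-! ### The cutoff and its error -/

/-- The error made in the backward heat equation when the heat kernel is multiplied by the cutoff
`(1 - (e x)²)²`. -/
noncomputable def cutoffError (e σ x : ℝ) : ℝ :=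
  heatKernel σ x * (4 * e ^ 2 * (x ^ 2 / σ) * (1 - (e * x) ^ 2) - 4 * e ^ 2
    + 12 * e ^ 2 * (e * x) ^ 2)

lemma abs_cutoffError_le {e σ x : ℝ} (hσ : 0 < σ) (hx : (e * x) ^ 2 ≤ 1) :
    |cutoffError e σ x| ≤ 40 * e ^ 2 * (exp (-(1 / (8 * σ)) * x ^ 2) / √(π * σ)) := by
  have hN := heatKernel_nonneg σ x
  -- With z = (ex)² in [0, 1], the factor -4 + 12z lies in [-4, 8].
  have h1 : |4 * e ^ 2 * (x ^ 2 / σ) * (1 - (e * x) ^ 2) - 4 * e ^ 2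
      + 12 * e ^ 2 * (e * x) ^ 2| ≤ 4 * e ^ 2 * (x ^ 2 / σ) + 8 * e ^ 2 := by
    have hz : 0 ≤ (e * x) ^ 2 := sq_nonneg _
    have hy : 0 ≤ e ^ 2 * (x ^ 2 / σ) := by positivity
    have he : 0 ≤ e ^ 2 := sq_nonneg _
    generalize (e * x) ^ 2 = z at *
    generalize x ^ 2 / σ = y at *
    rw [abs_le]
    constructor <;> nlinarith [mul_nonneg hy hz, mul_nonneg he hz,
      mul_nonneg hy (sub_nonneg.2 hx), mul_nonneg he (sub_nonneg.2 hx)]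
  unfold cutoffError
  rw [abs_mul, abs_of_nonneg hN]
  calc _ ≤ heatKernel σ x * (4 * e ^ 2 * (x ^ 2 / σ) + 8 * e ^ 2) := by gcongr
    _ = 4 * e ^ 2 * (heatKernel σ x * (x ^ 2 / σ)) + 8 * e ^ 2 * heatKernel σ x := by ring
    _ ≤ 4 * e ^ 2 * (8 * (exp (-(1 / (8 * σ)) * x ^ 2) / √(π * σ)))
        + 8 * e ^ 2 * (exp (-(1 / (8 * σ)) * x ^ 2) / √(π * σ)) := by
      exact add_le_add
        (mul_le_mul_of_nonneg_left (heatKernel_mul_sq_div_le hσ x) (by positivity))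
        (mul_le_mul_of_nonneg_left (heatKernel_le hσ x) (by positivity))
    _ = _ := by ring

/-- The bound does not depend on σ: the factor 1/√(πσ) cancels the width of the Gaussian, whose
half-line integral is √(8πσ)/2. The error thus stays harmless near the pole. -/
lemma abs_integral_cutoffError_le {e R σ M : ℝ} (hσ : 0 < σ) (hR : 0 ≤ R) (he : 0 ≤ e)
    (heR : e * R ≤ 1) {U : ℝ → ℝ} (hU : ∀ x ∈ Icc 0 R, |U x| ≤ M) :
    |∫ x in (0 : ℝ)..R, cutoffError e σ x * U x| ≤ 80 * e ^ 2 * M := by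
  have hM : 0 ≤ M := (abs_nonneg _).trans (hU 0 ⟨le_rfl, hR⟩)
  have hb : 0 < 1 / (8 * σ) := by positivity
  have hint : Integrable fun x : ℝ =>
      40 * e ^ 2 * M / √(π * σ) * exp (-(1 / (8 * σ)) * x ^ 2) :=
    (integrable_exp_neg_mul_sq hb).const_mul _
  have hval : √(π / (1 / (8 * σ))) = √8 * √(π * σ) := by
    rw [← Real.sqrt_mul (by norm_num)]; congr 1; field_simp
  have hs : 0 < √(π * σ) := by positivity
  have h8 : √8 ≤ 4 := Real.sqrt_le_iff.2 (by norm_num)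
  calc |∫ x in (0 : ℝ)..R, cutoffError e σ x * U x|
      ≤ ∫ x in (0 : ℝ)..R, 40 * e ^ 2 * M / √(π * σ) * exp (-(1 / (8 * σ)) * x ^ 2) := by
        rw [← Real.norm_eq_abs]
        refine intervalIntegral.norm_integral_le_of_norm_le hR
          (Eventually.of_forall fun x hx => ?_) hint.intervalIntegrable
        have hex : (e * x) ^ 2 ≤ 1 :=
          pow_le_one₀ (mul_nonneg he hx.1.le) ((mul_le_mul_of_nonneg_left hx.2 he).trans heR)
        rw [norm_mul, Real.norm_eq_abs, Real.norm_eq_abs]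
        calc _ ≤ 40 * e ^ 2 * (exp (-(1 / (8 * σ)) * x ^ 2) / √(π * σ)) * M :=
              mul_le_mul (abs_cutoffError_le hσ hex) (hU x ⟨hx.1.le, hx.2⟩) (abs_nonneg _)
                (by positivity)
          _ = _ := by ring
    _ ≤ ∫ x in Ioi (0 : ℝ), 40 * e ^ 2 * M / √(π * σ) * exp (-(1 / (8 * σ)) * x ^ 2) := by
        rw [intervalIntegral.integral_of_le hR]
        exact setIntegral_mono_set hint.integrableOn (ae_of_all _ fun x => by positivity)
          (LE.le.eventuallyLE Ioc_subset_Ioi_self)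
    _ = 20 * e ^ 2 * M * √8 := by
        rw [integral_const_mul, integral_gaussian_Ioi, hval]; field_simp; ring
    _ ≤ 80 * e ^ 2 * M := by nlinarith [mul_nonneg (sq_nonneg e) hM]

/-- Green's identity on `[0, t] × [0, 1 / e]` with the cut-off heat kernel as weight: the error is
quadratic in `e`. -/
lemma heat_green_cutoff {t T e M : ℝ} (ht : 0 ≤ t) (hT : t < T) (he : 0 < e)
    {U Ux Uxx : ℝ → ℝ → ℝ}
    (cU : ContinuousOn (Function.uncurry U) (Ici 0 ×ˢ Ici 0))
    (cUxx : ContinuousOn (Function.uncurry Uxx) (Ici 0 ×ˢ Ici 0))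
    (cUx : ContinuousOn (fun s => Ux s 0) (Ici 0))
    (dU : ∀ s ≥ 0, ∀ x ≥ 0, HasDerivAt (U s) (Ux s x) x)
    (dUx : ∀ s ≥ 0, ∀ x ≥ 0, HasDerivAt (Ux s) (Uxx s x) x)
    (dUt : ∀ s ≥ 0, ∀ x ≥ 0, HasDerivAt (fun r => U r x) (Uxx s x) s)
    (hM : ∀ s ≥ 0, ∀ x ≥ 0, |U s x| ≤ M) :
    |(∫ x in (0 : ℝ)..1 / e, heatKernel (T - t) x * (1 - (e * x) ^ 2) ^ 2 * U t x)
      - (∫ x in (0 : ℝ)..1 / e, heatKernel T x * (1 - (e * x) ^ 2) ^ 2 * U 0 x)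
      + ∫ s in (0 : ℝ)..t, heatKernel (T - s) 0 * Ux s 0| ≤ 80 * e ^ 2 * M * t := by
  have hR : 0 ≤ 1 / e := by positivity
  have heR : e * (1 / e) = 1 := by field_simp
  have hpos : ∀ s ∈ Icc 0 t, 0 < T - s := fun s hs => by linarith [hs.2]
  have hsub : Icc 0 t ×ˢ Icc 0 (1 / e) ⊆ Ici (0 : ℝ) ×ˢ Ici (0 : ℝ) :=
    prod_mono Icc_subset_Ici_self Icc_subset_Ici_self
  have cN : ContinuousOn (fun p : ℝ × ℝ => heatKernel (T - p.1) p.2)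
      (Icc 0 t ×ˢ Icc 0 (1 / e)) :=
    continuousOn_heatKernel.comp (f := fun p : ℝ × ℝ => (T - p.1, p.2)) (by fun_prop)
      fun p hp => ⟨hpos p.1 hp.1, mem_univ _⟩
  -- The outer square gives a double zero at x = 1/e, so both boundary terms there vanish; evenness
  -- in x keeps the derivative zero at x = 0.
  have dχ : ∀ x, HasDerivAt (fun x : ℝ => (1 - (e * x) ^ 2) ^ 2)
      (-4 * e ^ 2 * x * (1 - (e * x) ^ 2)) x := fun x => by
    refine (((((hasDerivAt_id x).const_mul e).pow 2).const_sub 1).pow 2).congr_deriv ?_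
    simp; ring
  have dχ' : ∀ x, HasDerivAt (fun x : ℝ => -4 * e ^ 2 * x * (1 - (e * x) ^ 2))
      (-4 * e ^ 2 + 12 * e ^ 2 * (e * x) ^ 2) x := fun x => by
    refine (((hasDerivAt_id x).const_mul (-4 * e ^ 2)).mul
      ((((hasDerivAt_id x).const_mul e).pow 2).const_sub 1)).congr_deriv ?_
    simp; ring
  have key := heat_green_identity ht hR (U := U) (Ux := Ux) (Uxx := Uxx)
    (K := fun s x => heatKernel (T - s) x * (1 - (e * x) ^ 2) ^ 2)
    (Kx := fun s x => heatKernel (T - s) x * (-x / (2 * (T - s))) * (1 - (e * x) ^ 2) ^ 2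
      + heatKernel (T - s) x * (-4 * e ^ 2 * x * (1 - (e * x) ^ 2)))
    (Kxx := fun s x => heatKernel (T - s) x *
      ((x ^ 2 / (4 * (T - s) ^ 2) - 1 / (2 * (T - s))) * (1 - (e * x) ^ 2) ^ 2
        + 4 * e ^ 2 * (x ^ 2 / (T - s)) * (1 - (e * x) ^ 2)
        + (-4 * e ^ 2 + 12 * e ^ 2 * (e * x) ^ 2)))
    (E := fun s x => cutoffError e (T - s) x)
    (cU.mono hsub) (cUxx.mono hsub) (cUx.mono Icc_subset_Ici_self)
    (cN.mul (by fun_prop))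
    (cN.mul (by
      have : ∀ p ∈ Icc 0 t ×ˢ Icc 0 (1 / e), T - p.1 ≠ 0 := fun p hp => (hpos p.1 hp.1).ne'
      refine (((ContinuousOn.sub (ContinuousOn.div (by fun_prop) (by fun_prop) ?_)
        (ContinuousOn.div (by fun_prop) (by fun_prop) ?_)).mul (by fun_prop)).add
        (ContinuousOn.mul (ContinuousOn.mul (by fun_prop)
          (ContinuousOn.div (by fun_prop) (by fun_prop) this)) (by fun_prop))).add (by fun_prop)
      · intro p hp; have := this p hp; positivity
      · intro p hp; have := this p hp; positivity))
    (by
      unfold cutoffError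
      have : ∀ p ∈ Icc 0 t ×ˢ Icc 0 (1 / e), T - p.1 ≠ 0 := fun p hp => (hpos p.1 hp.1).ne'
      exact cN.mul (((ContinuousOn.mul (ContinuousOn.mul (by fun_prop)
          (ContinuousOn.div (by fun_prop) (by fun_prop) this)) (by fun_prop)).sub
          (by fun_prop)).add (by fun_prop)))
    (fun s hs x hx => dU s hs.1 x hx.1) (fun s hs x hx => dUx s hs.1 x hx.1)
    (fun s hs x hx => dUt s hs.1 x hx.1)
    (fun s hs x hx => (hasDerivAt_heatKernel_space (T - s) x).mul (dχ x))
    (fun s hs x hx => by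
      have := hpos s hs
      refine ((((hasDerivAt_heatKernel_space (T - s) x).mul
        ((hasDerivAt_id x).neg.div_const (2 * (T - s)))).mul (dχ x)).add
        ((hasDerivAt_heatKernel_space (T - s) x).mul (dχ' x))).congr_deriv ?_
      simp only [id, Pi.neg_apply, Pi.mul_apply]
      generalize T - s = σ at this ⊢
      field_simp
      ring)
    (fun s hs x hx => by
      have := hpos s hs
      refine (((hasDerivAt_heatKernel_time this x).comp s
        ((hasDerivAt_id s).const_sub T)).mul_const ((1 - (e * x) ^ 2) ^ 2)).congr_deriv ?_
      unfold cutoffError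
      ring)
    (fun s hs => by simp only [heR]; ring)
    (fun s hs => by simp only [heR]; ring)
    (fun s hs => by simp)
  simp only [sub_zero, mul_zero, ne_eq, OfNat.ofNat_ne_zero, not_false_eq_true, zero_pow, one_pow,
    mul_one] at key
  rw [key, sub_add_cancel, ← Real.norm_eq_abs]
  have := intervalIntegral.norm_integral_le_of_norm_le_const (a := 0) (b := t)
    (f := fun s => ∫ x in (0 : ℝ)..1 / e, cutoffError e (T - s) x * U s x) (C := 80 * e ^ 2 * M)
    fun s hs => by
      rw [uIoc_of_le ht] at hs
      exact abs_integral_cutoffError_le (hpos s ⟨hs.1.le, hs.2⟩) hR he.le heR.le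
        fun x hx => hM s hs.1.le x hx.1
  simpa [abs_of_nonneg ht] using this

/-! ### Passage to the limit in the three boundary terms -/

/-- Dominated convergence for integrals over intervals which exhaust the half line. -/
lemma tendsto_intervalIntegral_of_dominated {b : ℝ → ℝ} {F : ℝ → ℝ → ℝ} {f bound : ℝ → ℝ}
    (hb : Tendsto b (𝓝[>] 0) atTop)
    (hF : ∀ e > 0, ContinuousOn (F e) (Ici 0))
    (h_bound : ∀ e ∈ Ioo (0 : ℝ) 1, ∀ x ∈ Ioc 0 (b e), |F e x| ≤ bound x)
    (hbound0 : ∀ x, 0 ≤ bound x)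
    (bound_int : IntegrableOn bound (Ioi 0))
    (h_lim : ∀ x > 0, Tendsto (fun e => F e x) (𝓝[>] 0) (𝓝 (f x))) :
    Tendsto (fun e => ∫ x in (0 : ℝ)..b e, F e x) (𝓝[>] 0) (𝓝 (∫ x in Ioi 0, f x)) := by
  have h01 : ∀ᶠ e : ℝ in 𝓝[>] 0, e ∈ Ioo (0 : ℝ) 1 := Ioo_mem_nhdsGT one_pos
  have key : Tendsto (fun e => ∫ x in Ioi 0, (Iic (b e)).indicator (F e) x) (𝓝[>] 0)
      (𝓝 (∫ x in Ioi 0, f x)) := by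
    refine tendsto_integral_filter_of_dominated_convergence bound ?_ ?_ bound_int ?_
    · filter_upwards [h01] with e he
      exact (((hF e he.1).mono Ioi_subset_Ici_self).aestronglyMeasurable
        measurableSet_Ioi).indicator measurableSet_Iic
    · filter_upwards [h01] with e he
      refine (ae_restrict_iff' measurableSet_Ioi).2 (ae_of_all _ fun x hx => ?_)
      by_cases hxb : x ≤ b e
      · rw [indicator_of_mem (mem_Iic.2 hxb)]
        exact h_bound e he x ⟨hx, hxb⟩
      · rw [indicator_of_notMem (by simpa using hxb)]
        simpa using hbound0 x
    · refine (ae_restrict_iff' measurableSet_Ioi).2 (ae_of_all _ fun x hx => ?_)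
      refine (h_lim x hx).congr' ?_
      filter_upwards [hb.eventually_ge_atTop x] with e he
      rw [indicator_of_mem (mem_Iic.2 he)]
  refine key.congr' ?_
  filter_upwards [hb.eventually_ge_atTop 0] with e he
  rw [intervalIntegral.integral_of_le he, setIntegral_indicator measurableSet_Iic, Ioi_inter_Iic]

lemma tendsto_one_div_nhdsGT_zero : Tendsto (fun e : ℝ => 1 / e) (𝓝[>] 0) atTop := by
  simpa using tendsto_inv_nhdsGT_zero (𝕜 := ℝ)

lemma abs_cutoff_le {y : ℝ} (h0 : 0 ≤ y) (h1 : y ≤ 1) : |(1 - y ^ 2) ^ 2| ≤ 1 := by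
  have h : y ^ 2 ≤ 1 := pow_le_one₀ h0 h1
  rw [abs_of_nonneg (sq_nonneg _)]
  exact pow_le_one₀ (by linarith) (by linarith [sq_nonneg y])

/-- The scaling x = √e y turns the concentrating kernels into one fixed Gaussian, so that dominated
convergence applies at the pole. -/
lemma sqrt_mul_heatKernel {e : ℝ} (he : 0 < e) (y : ℝ) :
    √e * heatKernel e (√e * y) = exp (-(1 / 4) * y ^ 2) / √π := by
  have h : √e ≠ 0 := by positivity
  unfold heatKernel
  rw [mul_pow, Real.sq_sqrt he.le, Real.sqrt_mul pi_pos.le,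
    show -(e * y ^ 2) / (4 * e) = -(1 / 4) * y ^ 2 by field_simp]
  field_simp

section limits

variable {u : ℝ → ℝ → ℝ} {M t : ℝ}

lemma tendsto_comp_quadrant {f : ℝ → ℝ → ℝ}
    (hf : ContinuousOn (Function.uncurry f) (Ici 0 ×ˢ Ici 0)) {a b : ℝ → ℝ}
    (ha : Continuous a) (hb : Continuous b) (ha0 : ∀ e ≥ 0, 0 ≤ a e) (hb0 : ∀ e ≥ 0, 0 ≤ b e) :
    Tendsto (fun e => f (a e) (b e)) (𝓝[>] 0) (𝓝 (f (a 0) (b 0))) := by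
  have hc : ContinuousOn (fun e => f (a e) (b e)) (Ici 0) :=
    hf.comp (f := fun e => (a e, b e)) (by fun_prop) fun e he => ⟨ha0 e he, hb0 e he⟩
  exact (hc 0 self_mem_Ici).mono_left (nhdsWithin_mono _ Ioi_subset_Ici_self)

/-- The cut-off heat kernels form an approximate identity at the boundary point. -/
lemma tendsto_integral_heatKernel_pole
    (cu : ContinuousOn (Function.uncurry u) (Ici 0 ×ˢ Ici 0))
    (hM : ∀ s > 0, ∀ x > 0, |u s x| ≤ M) (ht : 0 < t) :
    Tendsto (fun e => ∫ x in (0 : ℝ)..1 / e,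
      heatKernel e x * (1 - (e * x) ^ 2) ^ 2 * u (t + e) (x + e)) (𝓝[>] 0) (𝓝 (u t 0)) := by
  have hM0 : 0 ≤ M := (abs_nonneg _).trans (hM 1 one_pos 1 one_pos)
  have hgauss : IntegrableOn (fun y : ℝ => exp (-(1 / 4) * y ^ 2)) (Ioi 0) :=
    (integrable_exp_neg_mul_sq (by norm_num)).integrableOn
  have hπ : √π ≠ 0 := by positivity
  -- The half line already carries mass 1, so the limit is the full value u(t, 0) and not half of
  -- it.
  have hval : ∫ y in Ioi 0, exp (-(1 / 4) * y ^ 2) / √π * u t 0 = u t 0 := by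
    have h4 : √(π / (1 / 4)) = 2 * √π := by
      rw [show π / (1 / 4) = 2 ^ 2 * π by ring, Real.sqrt_mul (by norm_num),
        Real.sqrt_sq (by norm_num)]
    rw [integral_mul_const, integral_div, integral_gaussian_Ioi, h4]
    field_simp
  have hb : Tendsto (fun e : ℝ => 1 / √e * (1 / e)) (𝓝[>] 0) atTop := by
    refine Tendsto.atTop_mul_atTop₀ ?_ tendsto_one_div_nhdsGT_zero
    refine tendsto_one_div_nhdsGT_zero.comp (tendsto_nhdsWithin_iff.2 ⟨?_, ?_⟩)
    · have := (Real.continuous_sqrt.tendsto 0).mono_left (nhdsWithin_le_nhds (s := Ioi 0))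
      simpa using this
    · exact eventually_nhdsWithin_of_forall fun e he => Real.sqrt_pos.2 he
  have key := tendsto_intervalIntegral_of_dominated (b := fun e => 1 / √e * (1 / e))
    (F := fun e y => exp (-(1 / 4) * y ^ 2) / √π * (1 - (e * (√e * y)) ^ 2) ^ 2
      * u (t + e) (√e * y + e))
    (f := fun y => exp (-(1 / 4) * y ^ 2) / √π * u t 0)
    (bound := fun y => M / √π * exp (-(1 / 4) * y ^ 2)) hb
    (fun e he => by
      have : ContinuousOn (fun y => u (t + e) (√e * y + e)) (Ici 0) :=
        cu.comp (f := fun y => (t + e, √e * y + e)) (by fun_prop) fun y hy => by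
          have hy : 0 ≤ y := hy
          constructor <;> simp only [mem_Ici] <;> positivity
      exact ContinuousOn.mul (by fun_prop) this)
    (fun e he y hy => by
      have he0 := he.1
      have hs : 0 < √e := Real.sqrt_pos.2 he0
      have hy0 := hy.1
      have hy1 : e * (√e * y) ≤ 1 := by
        calc e * (√e * y) ≤ e * (√e * (1 / √e * (1 / e))) := by
              have := hy.2; gcongr
          _ = 1 := by field_simp
      rw [abs_mul, abs_mul, abs_of_nonneg (show 0 ≤ exp (-(1 / 4) * y ^ 2) / √π by positivity)]
      calc _ ≤ exp (-(1 / 4) * y ^ 2) / √π * 1 * M := by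
            gcongr
            · exact abs_cutoff_le (by positivity) hy1
            · exact hM _ (by positivity) _ (by positivity)
        _ = _ := by ring)
    (fun y => by positivity) (hgauss.const_mul _)
    (fun y hy => by
      have h1 : Tendsto (fun e => u (t + e) (√e * y + e)) (𝓝[>] 0) (𝓝 (u t 0)) := by
        simpa using tendsto_comp_quadrant cu (a := fun e => t + e) (b := fun e => √e * y + e)
          (by fun_prop) (by fun_prop) (fun e he => by positivity) (fun e he => by positivity)
      have h2 : Tendsto (fun e => exp (-(1 / 4) * y ^ 2) / √π * (1 - (e * (√e * y)) ^ 2) ^ 2)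
          (𝓝[>] 0) (𝓝 (exp (-(1 / 4) * y ^ 2) / √π)) := by
        have hc : Continuous fun e => exp (-(1 / 4) * y ^ 2) / √π
            * (1 - (e * (√e * y)) ^ 2) ^ 2 := by fun_prop
        simpa using (hc.tendsto 0).mono_left (nhdsWithin_le_nhds (s := Ioi 0))
      exact h2.mul h1)
  rw [hval] at key
  refine key.congr' (eventually_nhdsWithin_of_forall fun e he => ?_)
  have he : 0 < e := he
  have hs : √e ≠ 0 := by positivity
  have := intervalIntegral.integral_comp_mul_left (a := 0) (b := 1 / √e * (1 / e))
    (fun x => heatKernel e x * (1 - (e * x) ^ 2) ^ 2 * u (t + e) (x + e)) hs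
  rw [mul_zero, show √e * (1 / √e * (1 / e)) = 1 / e by field_simp, smul_eq_mul,
    eq_inv_mul_iff_mul_eq₀ hs, ← intervalIntegral.integral_const_mul] at this
  refine Eq.trans ?_ this
  refine intervalIntegral.integral_congr fun y _ => ?_
  simp only [← sqrt_mul_heatKernel he]
  ring

/-- Boundedness is assumed only for positive times; continuity carries it to time 0. -/
lemma abs_initial_le (cu : ContinuousOn (Function.uncurry u) (Ici 0 ×ˢ Ici 0))
    (hM : ∀ s > 0, ∀ x > 0, |u s x| ≤ M) {x : ℝ} (hx : 0 < x) : |u 0 x| ≤ M := by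
  have h : Tendsto (fun e => u e x) (𝓝[>] 0) (𝓝 (u 0 x)) :=
    tendsto_comp_quadrant cu (a := id) (b := fun _ => x) continuous_id continuous_const
      (fun e he => he) (fun _ _ => hx.le)
  exact le_of_tendsto h.abs (eventually_nhdsWithin_of_forall fun e he => hM e he x hx)

/-- A Gaussian majorant independent of e, for dominated convergence of the initial term. -/
lemma heatKernel_add_le (ht : 0 < t) {e : ℝ} (he : e ∈ Ioo (0 : ℝ) 1) (x : ℝ) :
    heatKernel (t + e) x ≤ exp (-(1 / (4 * (t + 1))) * x ^ 2) / √(π * t) := by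
  obtain ⟨h0, h1⟩ := he
  unfold heatKernel
  rw [show -x ^ 2 / (4 * (t + e)) = -(1 / (4 * (t + e)) * x ^ 2) by ring, neg_mul]
  gcongr
  linarith

lemma tendsto_integral_heatKernel_initial
    (cu : ContinuousOn (Function.uncurry u) (Ici 0 ×ˢ Ici 0))
    (hM : ∀ s > 0, ∀ x > 0, |u s x| ≤ M) (ht : 0 < t) :
    Tendsto (fun e => ∫ x in (0 : ℝ)..1 / e,
      heatKernel (t + e) x * (1 - (e * x) ^ 2) ^ 2 * u e (x + e)) (𝓝[>] 0)
      (𝓝 (∫ x in Ioi 0, heatKernel t x * u 0 x)) := by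
  have hM0 : 0 ≤ M := (abs_nonneg _).trans (hM 1 one_pos 1 one_pos)
  have hgauss : IntegrableOn (fun y : ℝ => exp (-(1 / (4 * (t + 1))) * y ^ 2)) (Ioi 0) :=
    (integrable_exp_neg_mul_sq (by positivity)).integrableOn
  refine tendsto_intervalIntegral_of_dominated
    (bound := fun y => M / √(π * t) * exp (-(1 / (4 * (t + 1))) * y ^ 2))
    tendsto_one_div_nhdsGT_zero (fun e he => ?_) (fun e he y hy => ?_)
    (fun y => by positivity) (hgauss.const_mul _) (fun y hy => ?_)
  · have h1 : ContinuousOn (fun y => u e (y + e)) (Ici 0) :=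
      cu.comp (f := fun y => (e, y + e)) (by fun_prop) fun y hy =>
        ⟨le_of_lt he, add_nonneg hy (le_of_lt he)⟩
    have h2 : Continuous (heatKernel (t + e)) :=
      continuous_iff_continuousAt.2 fun x => (hasDerivAt_heatKernel_space _ x).continuousAt
    exact ContinuousOn.mul (by fun_prop) h1
  · have he0 := he.1
    have hy0 := hy.1
    have hy1 : e * y ≤ 1 := by
      calc e * y ≤ e * (1 / e) := by have := hy.2; gcongr
        _ = 1 := by field_simp
    rw [abs_mul, abs_mul, abs_of_nonneg (heatKernel_nonneg _ _)]
    calc _ ≤ exp (-(1 / (4 * (t + 1))) * y ^ 2) / √(π * t) * 1 * M := by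
          gcongr
          · exact heatKernel_add_le ht he y
          · exact abs_cutoff_le (by positivity) hy1
          · exact hM _ he0 _ (by positivity)
      _ = _ := by ring
  · have h1 : Tendsto (fun e => u e (y + e)) (𝓝[>] 0) (𝓝 (u 0 y)) := by
      simpa using tendsto_comp_quadrant cu (a := fun e => e) (b := fun e => y + e)
        (by fun_prop) (by fun_prop) (fun e he => he) (fun e he => by positivity)
    have h2 : Tendsto (fun e => heatKernel (t + e) y * (1 - (e * y) ^ 2) ^ 2)
        (𝓝[>] 0) (𝓝 (heatKernel t y)) := by
      have hc : ContinuousAt (fun e => heatKernel (t + e) y * (1 - (e * y) ^ 2) ^ 2) 0 := by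
        refine ContinuousAt.mul (ContinuousAt.comp' (g := fun r => heatKernel r y) ?_
          (by fun_prop)) (by fun_prop)
        simpa using (hasDerivAt_heatKernel_time ht y).continuousAt
      simpa using hc.tendsto.mono_left (nhdsWithin_le_nhds (s := Ioi 0))
    exact h2.mul h1

/-- On the axis the kernel is τ^(-1/2)/√π, an integrable singularity. -/
lemma intervalIntegrable_heatKernel_zero (ht : 0 < t) :
    IntervalIntegrable (fun τ => heatKernel τ 0) volume 0 t := by
  have h : IntervalIntegrable (fun τ : ℝ => 1 / √π * τ ^ (-(1 / 2) : ℝ)) volume 0 t :=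
    (intervalIntegral.intervalIntegrable_rpow' (by norm_num)).const_mul _
  refine h.congr fun τ hτ => ?_
  rw [uIoc_of_le ht.le] at hτ
  simp only [heatKernel]
  rw [Real.sqrt_mul pi_pos.le, Real.rpow_neg hτ.1.le, ← Real.sqrt_eq_rpow]
  simp [mul_comm]

lemma exists_abs_le_near {w : ℝ → ℝ → ℝ}
    (cw : ContinuousOn (Function.uncurry w) (Ici 0 ×ˢ Ici 0)) (t : ℝ) :
    ∃ C, ∀ s ∈ Icc 0 t, ∀ x ∈ Icc (0 : ℝ) 1, |w s x| ≤ C := by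
  obtain ⟨C, hC⟩ := (isCompact_Icc.prod isCompact_Icc).exists_bound_of_continuousOn
    (cw.mono (prod_mono (Icc_subset_Ici_self (a := t) (b := 0))
      (Icc_subset_Ici_self (a := (1 : ℝ)) (b := 0))))
  exact ⟨C, fun s hs x hx => hC (s, x) ⟨hs, hx⟩⟩

lemma tendsto_integral_heatKernel_flux {w : ℝ → ℝ → ℝ}
    (cw : ContinuousOn (Function.uncurry w) (Ici 0 ×ˢ Ici 0)) (ht : 0 < t) :
    IntervalIntegrable (fun τ => heatKernel τ 0 * w (t - τ) 0) volume 0 t ∧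
    Tendsto (fun e => ∫ s in (0 : ℝ)..t, heatKernel (t + e - s) 0 * w (s + e) e) (𝓝[>] 0)
      (𝓝 (∫ τ in (0 : ℝ)..t, heatKernel τ 0 * w (t - τ) 0)) := by
  -- No global bound on w is available, but for e < 1 the points (t - τ + e, e) stay in the compact
  -- set [0, t + 1] × [0, 1].
  obtain ⟨C, hC⟩ := exists_abs_le_near cw (t + 1)
  have hint := intervalIntegrable_heatKernel_zero ht
  have c0 : ContinuousOn (fun τ => w (t - τ) 0) (Icc 0 t) :=
    cw.comp (f := fun τ => (t - τ, (0 : ℝ))) (by fun_prop) fun τ hτ =>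
      ⟨sub_nonneg.2 hτ.2, self_mem_Ici⟩
  refine ⟨hint.mul_continuousOn (by rwa [uIcc_of_le ht.le]), ?_⟩
  have h01 : ∀ᶠ e : ℝ in 𝓝[>] 0, e ∈ Ioo (0 : ℝ) 1 := Ioo_mem_nhdsGT one_pos
  -- In the reversed time τ = t - s the singularity stays at τ = 0, and the shifted kernel is
  -- dominated by its value at e = 0.
  have key : Tendsto (fun e => ∫ τ in (0 : ℝ)..t, heatKernel (τ + e) 0 * w (t - τ + e) e)
      (𝓝[>] 0) (𝓝 (∫ τ in (0 : ℝ)..t, heatKernel τ 0 * w (t - τ) 0)) := by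
    refine intervalIntegral.tendsto_integral_filter_of_dominated_convergence
      (fun τ => heatKernel τ 0 * C) ?_ ?_ (hint.mul_const C) ?_
    · filter_upwards [h01] with e he
      rw [uIoc_of_le ht.le]
      refine ContinuousOn.aestronglyMeasurable (ContinuousOn.mul ?_ ?_) measurableSet_Ioc
      · exact continuousOn_heatKernel.comp (f := fun τ => (τ + e, (0 : ℝ))) (by fun_prop)
          fun τ hτ => ⟨add_pos hτ.1 he.1, mem_univ _⟩
      · exact cw.comp (f := fun τ => (t - τ + e, e)) (by fun_prop)
          fun τ hτ => ⟨add_nonneg (sub_nonneg.2 hτ.2) he.1.le, he.1.le⟩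
    · filter_upwards [h01] with e he
      refine ae_of_all _ fun τ hτ => ?_
      rw [uIoc_of_le ht.le] at hτ
      obtain ⟨h0, h1⟩ := he
      obtain ⟨hτ0, hτ1⟩ := hτ
      rw [norm_mul, Real.norm_eq_abs, Real.norm_eq_abs, abs_of_nonneg (heatKernel_nonneg _ _)]
      refine mul_le_mul ?_ (hC _ ⟨by linarith, by linarith⟩ _ ⟨h0.le, h1.le⟩) (abs_nonneg _)
        (heatKernel_nonneg _ _)
      simp only [heatKernel, ne_eq, OfNat.ofNat_ne_zero, not_false_eq_true, zero_pow, neg_zero,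
        zero_div]
      gcongr
      linarith
    · refine ae_of_all _ fun τ hτ => ?_
      rw [uIoc_of_le ht.le] at hτ
      have h1 : Tendsto (fun e => w (t - τ + e) e) (𝓝[>] 0) (𝓝 (w (t - τ) 0)) := by
        simpa using tendsto_comp_quadrant cw (a := fun e => t - τ + e) (b := fun e => e)
          (by fun_prop) (by fun_prop) (fun e he => add_nonneg (sub_nonneg.2 hτ.2) he)
          (fun e he => he)
      refine Tendsto.mul ?_ h1
      have hc : ContinuousAt (fun e => heatKernel (τ + e) 0) 0 := by
        refine ContinuousAt.comp' (g := fun r => heatKernel r 0) ?_ (by fun_prop)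
        simpa using (hasDerivAt_heatKernel_time hτ.1 0).continuousAt
      simpa using hc.tendsto.mono_left (nhdsWithin_le_nhds (s := Ioi 0))
  refine key.congr fun e => ?_
  have := intervalIntegral.integral_comp_sub_left (a := 0) (b := t)
    (fun s => heatKernel (t + e - s) 0 * w (s + e) e) t
  rw [sub_self, sub_zero] at this
  rw [← this]
  refine intervalIntegral.integral_congr fun τ _ => ?_
  congr 2
  ring

end limits

/-! ### The representation formula and the theorem -/

/-- The representation formula for the lateral boundary values of a bounded solution. -/
lemma heat_boundary_representation {u : ℝ → ℝ → ℝ} {M t : ℝ}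
    (hux : MemCC1C2 u) (hut : MemC1C (Ioi 0) (Ioi 0) u)
    (hM : ∀ t > 0, ∀ x > 0, |u t x| ≤ M)
    (hheat : ∀ t > 0, ∀ x > 0, deriv (fun s => u s x) t = deriv (deriv (u t)) x) (ht : 0 < t) :
    u t 0 = (∫ x in Ioi 0, heatKernel t x * u 0 x)
      - ∫ τ in (0 : ℝ)..t, heatKernel τ 0 * derivWithin (u (t - τ)) (Ici 0) 0 := by
  obtain ⟨hreg, hu, hw, hq⟩ := hux
  have cu := hu.continuousOn_uncurry
  have cw := hw.continuousOn_uncurry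
  have cq := hq.continuousOn_uncurry
  have l1 := tendsto_integral_heatKernel_pole cu hM ht
  have l2 := tendsto_integral_heatKernel_initial cu hM ht
  have l3 := (tendsto_integral_heatKernel_flux cw ht).2
  have l := ((l1.sub l2).add l3).abs
  have lim0 : Tendsto (fun e : ℝ => 80 * e ^ 2 * M * t) (𝓝[>] 0) (𝓝 0) := by
    have hc : Continuous fun e : ℝ => 80 * e ^ 2 * M * t := by fun_prop
    simpa using (hc.tendsto 0).mono_left (nhdsWithin_le_nhds (s := Ioi 0))
  have hle := le_of_tendsto_of_tendsto l lim0 (eventually_nhdsWithin_of_forall fun e he => by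
    have he : 0 < e := he
    have hd : ∀ s ≥ 0, ∀ x > 0, derivWithin (u s) (Ici 0) x = deriv (u s) x := fun s _ x hx =>
      derivWithin_of_mem_nhds (Ici_mem_nhds hx)
    have d1 : ∀ s ≥ 0, ∀ x > 0, HasDerivAt (u s) (derivWithin (u s) (Ici 0) x) x :=
      fun s hs x hx => by
        rw [hd s hs x hx]
        exact (((hreg s hs).2.differentiableOn (by norm_num)).differentiableAt
          (Ioi_mem_nhds hx)).hasDerivAt
    have d2 : ∀ s ≥ 0, ∀ x > 0,
        HasDerivAt (derivWithin (u s) (Ici 0)) (deriv (deriv (u s)) x) x := fun s hs x hx => by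
      have h : DifferentiableAt ℝ (deriv (u s)) x :=
        (((hreg s hs).2.deriv_of_isOpen isOpen_Ioi (m := 1) (by norm_num)).differentiableOn
          (by norm_num)).differentiableAt (Ioi_mem_nhds hx)
      refine h.hasDerivAt.congr_of_eventuallyEq ?_
      filter_upwards [Ioi_mem_nhds hx] with y hy using hd s hs y hy
    have d3 : ∀ s > 0, ∀ x > 0, HasDerivAt (fun r => u r x) (deriv (deriv (u s)) x) s :=
      fun s hs x hx => by
        rw [← hheat s hs x hx]
        exact (hut.differentiableAt hs hx).hasDerivAt
    -- The shift by e in both variables makes the data regular on the closed quadrant; T = t + e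
    -- keeps T - s ≥ e on [0, t].
    have := heat_green_cutoff (t := t) (T := t + e) (M := M) ht.le (by linarith) he
      (U := fun s x => u (s + e) (x + e))
      (Ux := fun s x => derivWithin (u (s + e)) (Ici 0) (x + e))
      (Uxx := fun s x => deriv (deriv (u (s + e))) (x + e))
      (cu.comp (f := fun p : ℝ × ℝ => (p.1 + e, p.2 + e)) (by fun_prop) fun p hp =>
        ⟨add_nonneg hp.1 he.le, add_nonneg hp.2 he.le⟩)
      (cq.comp (f := fun p : ℝ × ℝ => (p.1 + e, p.2 + e)) (by fun_prop) fun p hp =>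
        ⟨add_nonneg hp.1 he.le, add_pos_of_nonneg_of_pos hp.2 he⟩)
      (cw.comp (f := fun s : ℝ => (s + e, 0 + e)) (by fun_prop) fun s hs =>
        ⟨add_nonneg hs he.le, by simpa using he.le⟩)
      (fun s hs x hx => (d1 (s + e) (by positivity) (x + e) (by positivity)).comp_add_const x e)
      (fun s hs x hx => (d2 (s + e) (by positivity) (x + e) (by positivity)).comp_add_const x e)
      (fun s hs x hx => (d3 (s + e) (by positivity) (x + e) (by positivity)).comp_add_const s e)
      (fun s hs x hx => hM _ (by positivity) _ (by positivity))
    simpa using this)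
  have := abs_nonpos_iff.1 hle
  linarith

theorem theorem2 (u : ℝ → ℝ → ℝ)
    (hux : MemCC1C2 u)
    (hut : MemC1C (Ioi 0) (Ioi 0) u)
    (hbdd : ∃ M : ℝ, ∀ t > 0, ∀ x > 0, |u t x| ≤ M)
    (hheat : ∀ t > 0, ∀ x > 0, deriv (fun s => u s x) t = deriv (deriv (u t)) x) :
    ∃ v φ ψ : ℝ → ℝ,
      (∀ x > 0, Tendsto (fun t => u t x) (𝓝[>] 0) (𝓝 (v x)) ∧ v x = u 0 x) ∧
      (∀ t > 0, Tendsto (fun x => u t x) (𝓝[>] 0) (𝓝 (φ t)) ∧ φ t = u t 0) ∧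
      (∀ t > 0, Tendsto (fun x => deriv (u t) x) (𝓝[>] 0) (𝓝 (ψ t)) ∧
        HasDerivWithinAt (u t) (ψ t) (Ici 0) 0) ∧
      ContinuousOn v (Ioi 0) ∧ ContinuousOn φ (Ioi 0) ∧ ContinuousOn ψ (Ioi 0) ∧
      ∀ t > 0,
        IntegrableOn (fun ξ => exp (-ξ ^ 2 / (4 * t)) * v ξ) (Ioi 0) ∧
        IntervalIntegrable (fun τ => 1 / √τ * ψ (t - τ)) volume 0 t ∧
        φ t = 1 / √(π * t) * (∫ ξ in Ioi 0, exp (-ξ ^ 2 / (4 * t)) * v ξ)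
          - 1 / √π * ∫ τ in (0 : ℝ)..t, 1 / √τ * ψ (t - τ) := by
  obtain ⟨M, hM⟩ := hbdd
  have cu := hux.2.1.continuousOn_uncurry
  have cw := hux.2.2.1.continuousOn_uncurry
  have slice_x : ∀ {f : ℝ → ℝ → ℝ}, ContinuousOn (Function.uncurry f) (Ici 0 ×ˢ Ici 0) →
      ∀ t ≥ 0, ContinuousOn (f t) (Ici 0) := fun hf t ht =>
    hf.comp (f := fun x => (t, x)) (by fun_prop) fun x hx => ⟨ht, hx⟩
  have slice_t : ∀ {f : ℝ → ℝ → ℝ}, ContinuousOn (Function.uncurry f) (Ici 0 ×ˢ Ici 0) →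
      ∀ x ≥ 0, ContinuousOn (fun t => f t x) (Ici 0) := fun hf x hx =>
    hf.comp (f := fun t => (t, x)) (by fun_prop) fun t ht => ⟨ht, hx⟩
  have at_zero : ∀ {g : ℝ → ℝ}, ContinuousOn g (Ici 0) → Tendsto g (𝓝[>] 0) (𝓝 (g 0)) :=
    fun hg => (hg 0 self_mem_Ici).mono_left (nhdsWithin_mono _ Ioi_subset_Ici_self)
  refine ⟨u 0, fun t => u t 0, fun t => derivWithin (u t) (Ici 0) 0,
    fun x hx => ⟨at_zero (slice_t cu x hx.le), rfl⟩, fun t ht => ⟨at_zero (slice_x cu t ht.le), rfl⟩,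
    fun t ht => ⟨?_, ?_⟩, (slice_x cu 0 le_rfl).mono Ioi_subset_Ici_self,
    (slice_t cu 0 le_rfl).mono Ioi_subset_Ici_self,
    (slice_t cw 0 le_rfl).mono Ioi_subset_Ici_self, fun t ht => ⟨?_, ?_, ?_⟩⟩
  -- The one-sided derivative agrees with `deriv` for x > 0 and, unlike it, is continuous up to x =
  -- 0.
  · refine (at_zero (slice_x cw t ht.le)).congr' (eventually_nhdsWithin_of_forall fun x hx => ?_)
    exact derivWithin_of_mem_nhds (Ici_mem_nhds hx)
  · exact (((hux.1 t ht.le).1.differentiableOn (by norm_num)) 0 self_mem_Ici).hasDerivWithinAt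
  · have hg : Integrable fun ξ : ℝ => M * exp (-(1 / (4 * t)) * ξ ^ 2) :=
      (integrable_exp_neg_mul_sq (by positivity)).const_mul M
    refine hg.integrableOn.mono' (ContinuousOn.aestronglyMeasurable (ContinuousOn.mul
      (by fun_prop) ((slice_x cu 0 le_rfl).mono Ioi_subset_Ici_self)) measurableSet_Ioi)
      ((ae_restrict_iff' measurableSet_Ioi).2 (ae_of_all _ fun ξ hξ => ?_))
    rw [norm_mul, Real.norm_eq_abs, Real.norm_eq_abs, abs_exp, mul_comm,
      show -ξ ^ 2 / (4 * t) = -(1 / (4 * t)) * ξ ^ 2 by ring]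
    exact mul_le_mul_of_nonneg_right (abs_initial_le cu hM hξ) (exp_pos _).le
  · refine ((tendsto_integral_heatKernel_flux cw ht).1.const_mul √π).congr fun τ _ => ?_
    simp only [heatKernel, Real.sqrt_mul pi_pos.le]
    have : √π ≠ 0 := by positivity
    simp
    field_simp
  · change u t 0 = _
    rw [heat_boundary_representation hux hut hM hheat ht, ← integral_const_mul,
      ← intervalIntegral.integral_const_mul]
    congr 1
    · congr 1 with x
      unfold heatKernel; ring
    · congr 1 with τ
      simp only [heatKernel, Real.sqrt_mul pi_pos.le]
      simp
      ring
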